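/- **Discriminant.** For real $\alpha,\beta$ and $0<\gamma<\pi/2$ let $$P_{\alpha,\beta,\gamma}(\varphi)=\varphi^2+4\varphi\cos\alpha\cos\beta+4\,\frac{(\cos^2\alpha-\cos^2\gamma)(\cos^2\beta-\cos^2\gamma)}{\sin^2\gamma}$$ and let $\Delta_{\alpha,\beta,\gamma}$ be the discriminant of this polynomial in $\varphi$. Let $a,b,c$ be positive integers and $n=abc$. Let $\alpha=\frac{i\pi}{a}$ and $\beta=\frac{j\pi}{b}$ with integers $1\le i\le\frac{a-1}{2}$ and $1\le j\le b-1$. (1) For every $\gamma=\frac{k\pi}{c}$ with $k$ an integer, $1\le k<\frac c2$, either $\Delta_{\alpha,\beta,\gamma}=0$ or $|\Delta_{\alpha,\beta,\gamma}|\ge 2^{-6n}$. (2) Suppose moreover that $a$ and $b$ are coprime and $\beta\ne\frac{\pi}{2}$. Then for every $\gamma=\frac{k\pi}{c}$ with $1\le k<\frac c2$ the polynomial $P_{\alpha,\beta,\gamma}$ has no double root (real or complex). Furthermore there is $\gamma_0=k_0\frac{\pi}{c}$, with $k_0$ an integer that does not depend on $k$, $1\le k_0\le\lceil\frac c2\rceil$,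 and $k_0\le\lfloor\frac c2\rfloor$ whenever $a\le c$ or $b\le c$, such that for every $\gamma=\frac{k\pi}{c}$ with $1\le k<\frac c2$: - if $\gamma<\gamma_0$, then $\Delta_{\alpha,\beta,\gamma}<0$; - if $\gamma\ge\gamma_0$, then $\Delta_{\alpha,\beta,\gamma}\ge 2^{-6n}$. -/

import Mathlib

open Polynomial in
/-- The polynomial `P_{α,β,γ}` in the variable `φ`: it is `φ + 2 cos α cos β` for `γ = π/2`, and
`φ² + 4 cos α cos β φ + 4 (cos² α - cos² γ)(cos² β - cos² γ) / sin² γ` otherwise. -/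
noncomputable def factorPoly (α β γ : ℝ) : ℝ[X] :=
  open Classical in
  if γ = Real.pi / 2 then X + C (2 * Real.cos α * Real.cos β)
  else X ^ 2 + C (4 * Real.cos α * Real.cos β) * X +
    C (4 * ((Real.cos α ^ 2 - Real.cos γ ^ 2) * (Real.cos β ^ 2 - Real.cos γ ^ 2)) /
      Real.sin γ ^ 2)

/-- The discriminant `Δ_{α,β,γ}` of `P_{α,β,γ}`. -/
noncomputable def factorDiscr (α β γ : ℝ) : ℝ := (factorPoly α β γ).discr

/-- A real polynomial has a double root if some complex number is a root of multiplicity at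
least two. -/
def HasDoubleRoot (p : Polynomial ℝ) : Prop :=
  ∃ z : ℂ, 2 ≤ (p.map (algebraMap ℝ ℂ)).rootMultiplicity z

/-! Writing every cosine through sines gives Δ = 16 cot²γ (sin²γ - sin²α sin²β) (`factorDiscr_eq`).
With u = exp(2iα), (1 - u)(1 - u⁻¹) = 4 sin²α, so 16(sin²γ - sin²α sin²β) is an algebraic integer in
the n-th cyclotomic field. Its conjugates are bounded by 32 and there are at most n of them, so if
nonzero it is at least 32^(1-n) in absolute value; the bound cot²γ ≥ 1/c² costs only the remaining
factor.

For coprime a, b one denominator is odd, and a congruence modulo 4 excludes sin α sin β = sin γ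
(`one_sub_mul_one_sub_inv_mul_ne_of_odd`). As the sine increases on [0, π/2], Δ changes sign at most
once in k, from negative to positive, and k₀ marks the change. -/

/-! ### Norms of algebraic integers. -/

section AlgebraicIntegers

/-- The absolute values of the conjugates of a nonzero algebraic integer multiply to at least
one. -/
theorem one_le_prod_norm_embeddings {K : Type*} [Field K] [NumberField K] {x : K}
    (hx : IsIntegral ℤ x) (h0 : x ≠ 0) : 1 ≤ ∏ σ : K →ₐ[ℚ] ℂ, ‖σ x‖ := by
  obtain ⟨m, hm⟩ := IsIntegrallyClosed.isIntegral_iff.1 (Algebra.isIntegral_norm ℚ hx)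
  have hm0 : m ≠ 0 := by
    rintro rfl
    rw [map_zero] at hm
    exact h0 (Algebra.norm_eq_zero_iff.1 hm.symm)
  rw [← norm_prod, ← Algebra.norm_eq_prod_embeddings ℚ ℂ x, ← hm]
  simpa using (show (1 : ℝ) ≤ |(m : ℝ)| by exact_mod_cast Int.one_le_abs hm0)

theorem exists_one_le_norm_embedding {K : Type*} [Field K] [NumberField K] {x : K}
    (hx : IsIntegral ℤ x) (h0 : x ≠ 0) : ∃ σ : K →ₐ[ℚ] ℂ, 1 ≤ ‖σ x‖ := by
  by_contra! h
  refine (one_le_prod_norm_embeddings hx h0).not_gt ?_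
  have hpos : ∀ σ : K →ₐ[ℚ] ℂ, 0 < ‖σ x‖ := fun σ => by simpa using h0
  let τ : K →ₐ[ℚ] ℂ := IsAlgClosed.lift
  calc ∏ σ : K →ₐ[ℚ] ℂ, ‖σ x‖ < ∏ _σ : K →ₐ[ℚ] ℂ, (1 : ℝ) :=
        Finset.prod_lt_prod (fun σ _ => hpos σ) (fun σ _ => (h σ).le) ⟨τ, Finset.mem_univ _, h τ⟩
    _ = 1 := by simp

/-- A Liouville-type bound: an algebraic integer with bounded conjugates is not too small. -/
theorem one_le_norm_mul_pow_of_norm_embedding_le {K : Type*} [Field K] [NumberField K] {x : K}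
    (hx : IsIntegral ℤ x) (h0 : x ≠ 0) {M : ℝ} (hM : ∀ σ : K →ₐ[ℚ] ℂ, ‖σ x‖ ≤ M)
    (φ : K →ₐ[ℚ] ℂ) : 1 ≤ ‖φ x‖ * M ^ (Module.finrank ℚ K - 1) := by
  classical
  refine (one_le_prod_norm_embeddings hx h0).trans ?_
  rw [← Finset.mul_prod_erase _ _ (Finset.mem_univ φ)]
  gcongr
  calc ∏ σ ∈ Finset.univ.erase φ, ‖σ x‖ ≤ ∏ σ ∈ Finset.univ.erase φ, M :=
        Finset.prod_le_prod (fun _ _ => norm_nonneg _) (fun σ _ => hM σ)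
    _ = M ^ (Module.finrank ℚ K - 1) := by
        rw [Finset.prod_const, Finset.card_erase_of_mem (Finset.mem_univ φ), Finset.card_univ,
          AlgHom.card]

end AlgebraicIntegers

/-! ### Roots of unity and cyclotomic fields. -/

section RootsOfUnity

theorem isIntegral_of_pow_eq_one {K : Type*} [CommRing K] {u : K} {n : ℕ} (hn : 0 < n)
    (hu : u ^ n = 1) : IsIntegral ℤ u :=
  IsIntegral.of_pow hn (hu ▸ isIntegral_one)

theorem isIntegral_one_sub_mul_one_sub_inv {K : Type*} [Field K] {u : K} {n : ℕ} (hn : 0 < n)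
    (hu : u ^ n = 1) : IsIntegral ℤ ((1 - u) * (1 - u⁻¹)) :=
  (isIntegral_one.sub (isIntegral_of_pow_eq_one hn hu)).mul
    (isIntegral_one.sub (isIntegral_of_pow_eq_one hn (by rw [inv_pow, hu, inv_one])))

/-- The powers of v sum to zero over a full period, so b = ∑ (1 - v^k), and 1 - v divides each term.
-/
theorem exists_isIntegral_one_sub_mul_eq_natCast {K : Type*} [Field K] {v : K} {b : ℕ}
    (hb : 0 < b) (hv : v ^ b = 1) (h1 : v ≠ 1) : ∃ y, IsIntegral ℤ y ∧ (1 - v) * y = b := by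
  refine ⟨∑ k ∈ Finset.range b, ∑ l ∈ Finset.range k, v ^ l,
    IsIntegral.sum _ fun k _ => IsIntegral.sum _ fun l _ =>
      (isIntegral_of_pow_eq_one hb hv).pow l, ?_⟩
  have hgeom : ∑ k ∈ Finset.range b, v ^ k = 0 := by
    rw [geom_sum_eq h1, hv, sub_self, zero_div]
  rw [Finset.mul_sum, Finset.sum_congr rfl fun k _ => mul_neg_geom_sum v k]
  rw [Finset.sum_sub_distrib, hgeom]
  simp

/-- A quarter of `(1 - u) (1 - u⁻¹)` is not an algebraic integer for a root of unity `u` other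
than `±1`: all of its conjugates lie strictly between `0` and `1`. -/
theorem not_isIntegral_quarter_one_sub_mul_one_sub_inv {K : Type*} [Field K] [NumberField K]
    {u : K} {n : ℕ} (hn : 0 < n) (hu : u ^ n = 1) (hu2 : u ^ 2 ≠ 1) {s : K}
    (hs : (1 - u) * (1 - u⁻¹) = 4 * s) : ¬ IsIntegral ℤ s := by
  intro hint
  have hu1 : u ≠ 1 := by rintro rfl; exact hu2 (one_pow 2)
  have hui : u⁻¹ ≠ 1 := inv_ne_one.2 hu1
  have hs0 : s ≠ 0 := by
    rintro rfl
    rw [mul_zero, mul_eq_zero, sub_eq_zero, sub_eq_zero] at hs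
    exact hs.elim (fun h => hu1 h.symm) fun h => hui h.symm
  obtain ⟨σ, hσ⟩ := exists_one_le_norm_embedding hint hs0
  have hz : ‖σ u‖ = 1 :=
    Complex.norm_eq_one_of_pow_eq_one (n := n) (by rw [← map_pow, hu, map_one]) hn.ne'
  have hz1 : σ u ≠ -1 := by
    intro h
    apply hu2
    apply show Function.Injective σ from σ.injective
    rw [map_pow, h, map_one]
    norm_num
  -- On the unit circle the distance 2 from 1 is attained only at -1.
  have hlt : ‖1 - σ u‖ < 2 := by
    refine lt_of_le_of_ne ((norm_sub_le _ _).trans (by rw [hz, norm_one]; norm_num)) fun h => hz1 ?_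
    have hn1 : Complex.normSq (1 - σ u) = 4 := by rw [Complex.normSq_eq_norm_sq, h]; norm_num
    have hn2 : Complex.normSq (σ u) = 1 := by rw [Complex.normSq_eq_norm_sq, hz]; norm_num
    rw [Complex.normSq_apply] at hn1 hn2
    simp only [Complex.sub_re, Complex.one_re, Complex.sub_im, Complex.one_im] at hn1
    have hre : (σ u).re = -1 := by nlinarith
    have him : (σ u).im = 0 := by
      rw [hre] at hn2
      nlinarith
    apply Complex.ext <;> simp [hre, him]
  have hle : ‖1 - (σ u)⁻¹‖ ≤ 2 :=
    (norm_sub_le _ _).trans (by rw [norm_inv, hz, norm_one]; norm_num)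
  have h4 : ‖1 - σ u‖ * ‖1 - (σ u)⁻¹‖ = 4 * ‖σ s‖ := by
    have := congrArg (fun t => ‖σ t‖) hs
    simpa [map_ofNat] using this
  nlinarith [norm_nonneg (1 - σ u)]

/-- Both 1 - v and 1 - v⁻¹ divide b, so equality would make 4 divide b²(1 - u)(1 - u⁻¹). Since b² ≡
1 mod 4, it would divide (1 - u)(1 - u⁻¹) itself, which is impossible. -/
theorem one_sub_mul_one_sub_inv_mul_ne_of_odd {K : Type*} [Field K] [NumberField K]
    {u v w : K} {a b c : ℕ} (ha : 0 < a) (hc : 0 < c) (hb : Odd b)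
    (hu : u ^ a = 1) (hv : v ^ b = 1) (hw : w ^ c = 1) (hu2 : u ^ 2 ≠ 1) (hv1 : v ≠ 1) :
    (1 - u) * (1 - u⁻¹) * ((1 - v) * (1 - v⁻¹)) ≠ 4 * ((1 - w) * (1 - w⁻¹)) := by
  intro h
  obtain ⟨y, hy, hvy⟩ := exists_isIntegral_one_sub_mul_eq_natCast hb.pos hv hv1
  obtain ⟨z, hz, hvz⟩ := exists_isIntegral_one_sub_mul_eq_natCast (v := v⁻¹) hb.pos
    (by rw [inv_pow, hv, inv_one]) (inv_ne_one.2 hv1)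
  have hp := isIntegral_one_sub_mul_one_sub_inv ha hu
  have hr := isIntegral_one_sub_mul_one_sub_inv hc hw
  obtain ⟨t, ht⟩ : ∃ t : ℕ, b = 2 * t + 1 := hb
  have hbK : (b : K) = 2 * t + 1 := by rw [ht]; push_cast; ring
  have hbb : (1 - u) * (1 - u⁻¹) * (b * b : K) = 4 * ((1 - w) * (1 - w⁻¹) * (y * z)) := by
    rw [← hvy]
    nth_rewrite 2 [hvy]
    rw [← hvz]
    linear_combination y * z * h
  have hnat : IsIntegral ℤ ((t * t + t : ℕ) : K) := by
    simpa using isIntegral_algebraMap (R := ℤ) (A := K) (x := ((t * t + t : ℕ) : ℤ))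
  refine not_isIntegral_quarter_one_sub_mul_one_sub_inv ha hu hu2
    (s := (1 - w) * (1 - w⁻¹) * (y * z) - ((t * t + t : ℕ) : K) * ((1 - u) * (1 - u⁻¹))) ?_
    ((hr.mul (hy.mul hz)).sub (hnat.mul hp))
  rw [hbK] at hbb
  push_cast
  linear_combination hbb

instance isCyclotomicExtension_ratAlgebra (n : ℕ) [NeZero n] :
    IsCyclotomicExtension {n} ℚ (CyclotomicField n ℚ) := by
  have h := CyclotomicField.isCyclotomicExtension n ℚ
  rwa [Subsingleton.elim (CyclotomicField.algebra n ℚ) DivisionRing.toRatAlgebra] at h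

theorem exists_cyclotomicField_pow_eq_one (n : ℕ) [NeZero n] (φ : CyclotomicField n ℚ →ₐ[ℚ] ℂ)
    {u : ℂ} (hu : u ^ n = 1) : ∃ u' : CyclotomicField n ℚ, u' ^ n = 1 ∧ φ u' = u := by
  have hζ := IsCyclotomicExtension.zeta_spec n ℚ (CyclotomicField n ℚ)
  have hφ : Function.Injective φ := φ.injective
  obtain ⟨i, -, hi⟩ := (hζ.map_of_injective hφ).eq_pow_of_pow_eq_one hu
  refine ⟨IsCyclotomicExtension.zeta n ℚ (CyclotomicField n ℚ) ^ i, ?_, by rw [map_pow, hi]⟩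
  rw [← pow_mul, mul_comm, pow_mul, hζ.pow_eq_one, one_pow]

theorem norm_one_sub_mul_one_sub_inv_le {z : ℂ} (hz : ‖z‖ = 1) :
    ‖(1 - z) * (1 - z⁻¹)‖ ≤ 4 := by
  have h1 : ‖1 - z‖ ≤ 2 := (norm_sub_le _ _).trans (by rw [hz, norm_one]; norm_num)
  have h2 : ‖1 - z⁻¹‖ ≤ 2 :=
    (norm_sub_le _ _).trans (by rw [norm_inv, hz, norm_one]; norm_num)
  rw [norm_mul]
  nlinarith [norm_nonneg (1 - z), norm_nonneg (1 - z⁻¹)]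

/-- Every conjugate has the same shape with other n-th roots of unity, hence norm at most 4·4 + 4·4
= 32; the degree is φ(n) ≤ n. -/
theorem one_le_norm_mul_pow_of_pow_eq_one {n : ℕ} (hn : 0 < n) {u v w : ℂ}
    (hu : u ^ n = 1) (hv : v ^ n = 1) (hw : w ^ n = 1)
    (h0 : 4 * ((1 - w) * (1 - w⁻¹)) - (1 - u) * (1 - u⁻¹) * ((1 - v) * (1 - v⁻¹)) ≠ 0) :
    1 ≤ ‖4 * ((1 - w) * (1 - w⁻¹)) - (1 - u) * (1 - u⁻¹) * ((1 - v) * (1 - v⁻¹))‖ *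
      32 ^ (n - 1) := by
  have : NeZero n := ⟨hn.ne'⟩
  let φ : CyclotomicField n ℚ →ₐ[ℚ] ℂ := IsAlgClosed.lift
  obtain ⟨u', hu', rfl⟩ := exists_cyclotomicField_pow_eq_one n φ hu
  obtain ⟨v', hv', rfl⟩ := exists_cyclotomicField_pow_eq_one n φ hv
  obtain ⟨w', hw', rfl⟩ := exists_cyclotomicField_pow_eq_one n φ hw
  set x := 4 * ((1 - w') * (1 - w'⁻¹)) - (1 - u') * (1 - u'⁻¹) * ((1 - v') * (1 - v'⁻¹)) with hx
  have hmap : ∀ σ : CyclotomicField n ℚ →ₐ[ℚ] ℂ, σ x =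
      4 * ((1 - σ w') * (1 - (σ w')⁻¹)) -
        (1 - σ u') * (1 - (σ u')⁻¹) * ((1 - σ v') * (1 - (σ v')⁻¹)) := by
    intro σ
    simp [hx, map_ofNat]
  rw [← hmap] at h0 ⊢
  have hint : IsIntegral ℤ x := by
    have h4 : IsIntegral ℤ (4 : CyclotomicField n ℚ) := by
      simpa using isIntegral_algebraMap (R := ℤ) (A := CyclotomicField n ℚ) (x := 4)
    exact (h4.mul (isIntegral_one_sub_mul_one_sub_inv hn hw')).sub
      ((isIntegral_one_sub_mul_one_sub_inv hn hu').mul (isIntegral_one_sub_mul_one_sub_inv hn hv'))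
  have hle : ∀ σ : CyclotomicField n ℚ →ₐ[ℚ] ℂ, ‖σ x‖ ≤ 32 := by
    intro σ
    have hunit : ∀ z : CyclotomicField n ℚ, z ^ n = 1 → ‖σ z‖ = 1 := fun z hz =>
      Complex.norm_eq_one_of_pow_eq_one (n := n) (by rw [← map_pow, hz, map_one]) hn.ne'
    have h1 := norm_one_sub_mul_one_sub_inv_le (hunit u' hu')
    have h2 := norm_one_sub_mul_one_sub_inv_le (hunit v' hv')
    have h3 := norm_one_sub_mul_one_sub_inv_le (hunit w' hw')
    rw [hmap]
    refine (norm_sub_le _ _).trans ?_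
    rw [norm_mul 4, norm_mul ((1 - σ u') * _), show ‖(4 : ℂ)‖ = 4 by norm_num]
    have := mul_le_mul h1 h2 (norm_nonneg _) (by norm_num)
    linarith
  refine (one_le_norm_mul_pow_of_norm_embedding_le hint (by rintro h; simp [h] at h0) hle φ).trans ?_
  gcongr
  · norm_num
  · rw [IsCyclotomicExtension.finrank (CyclotomicField n ℚ)
      (Polynomial.cyclotomic.irreducible_rat hn)]
    exact Nat.totient_le n

end RootsOfUnity

/-! ### Sines at rational multiples of π. -/

section Trigonometry

theorem one_sub_exp_mul_one_sub_exp_inv (x : ℝ) :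
    (1 - Complex.exp (2 * x * Complex.I)) * (1 - (Complex.exp (2 * x * Complex.I))⁻¹) =
      ((4 * Real.sin x ^ 2 : ℝ) : ℂ) := by
  have h2 : Complex.exp (2 * x * Complex.I) = Complex.exp (x * Complex.I) ^ 2 := by
    rw [← Complex.exp_nat_mul]; congr 1; push_cast; ring
  have hs : Complex.exp (x * Complex.I) = Complex.cos x + Complex.sin x * Complex.I :=
    Complex.exp_mul_I x
  have hne : Complex.exp (2 * x * Complex.I) ≠ 0 := Complex.exp_ne_zero _
  have hcs := Complex.sin_sq_add_cos_sq (x : ℂ)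
  have hI := Complex.I_sq
  have hinv : (Complex.exp (2 * x * Complex.I))⁻¹ =
      (Complex.cos x - Complex.sin x * Complex.I) ^ 2 := by
    apply inv_eq_of_mul_eq_one_right
    rw [h2, hs]
    rw [← mul_pow]
    have : (Complex.cos x + Complex.sin x * Complex.I) *
        (Complex.cos x - Complex.sin x * Complex.I) = 1 := by
      linear_combination hcs - Complex.sin x ^ 2 * hI
    rw [this, one_pow]
  rw [hinv, h2, hs]
  push_cast
  generalize Complex.cos x = C at *
  generalize Complex.sin x = S at *
  have hC : C ^ 2 = 1 - S ^ 2 := by linear_combination hcs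
  have e1 : (C + S * Complex.I) ^ 2 = 1 - 2 * S ^ 2 + 2 * C * S * Complex.I := by
    linear_combination hC + S ^ 2 * hI
  have e2 : (C - S * Complex.I) ^ 2 = 1 - 2 * S ^ 2 - 2 * C * S * Complex.I := by
    linear_combination hC + S ^ 2 * hI
  rw [e1, e2]
  linear_combination (-4 * C ^ 2 * S ^ 2) * hI + 4 * S ^ 2 * hC

theorem exp_two_mul_pow_eq_one {m a : ℕ} (ha : 0 < a) {x : ℝ} (hx : x = m * Real.pi / a) :
    Complex.exp (2 * x * Complex.I) ^ a = 1 := by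
  rw [← Complex.exp_nat_mul, Complex.exp_eq_one_iff]
  refine ⟨m, ?_⟩
  have : (a : ℂ) ≠ 0 := by exact_mod_cast ha.ne'
  rw [hx]
  push_cast
  field_simp

theorem exp_two_mul_ne_one {x : ℝ} (hx : Real.sin x ≠ 0) : Complex.exp (2 * x * Complex.I) ≠ 1 := by
  intro h
  have := one_sub_exp_mul_one_sub_exp_inv x
  rw [h, sub_self, zero_mul] at this
  have h0 : 4 * Real.sin x ^ 2 = 0 := by exact_mod_cast this.symm
  exact hx (by nlinarith)

theorem exp_two_mul_sq_ne_one {x : ℝ} (hx : Real.sin x ≠ 0) (hc : Real.cos x ≠ 0) :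
    Complex.exp (2 * x * Complex.I) ^ 2 ≠ 1 := by
  have h : Complex.exp (2 * x * Complex.I) ^ 2 = Complex.exp (2 * (2 * x : ℝ) * Complex.I) := by
    rw [← Complex.exp_nat_mul]; congr 1; push_cast; ring
  rw [h]
  refine exp_two_mul_ne_one ?_
  rw [Real.sin_two_mul]
  positivity

/-- A Liouville-type bound for `sin² γ - sin² α sin² β` at rational multiples of `π`. -/
theorem one_le_abs_sin_sq_sub_mul_pow {i j k a b c : ℕ} (ha : 0 < a) (hb : 0 < b) (hc : 0 < c)
    {α β γ : ℝ} (hα : α = i * Real.pi / a) (hβ : β = j * Real.pi / b) (hγ : γ = k * Real.pi / c)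
    (h0 : Real.sin γ ^ 2 - Real.sin α ^ 2 * Real.sin β ^ 2 ≠ 0) :
    1 ≤ |16 * (Real.sin γ ^ 2 - Real.sin α ^ 2 * Real.sin β ^ 2)| * 32 ^ (a * b * c - 1) := by
  have key := one_le_norm_mul_pow_of_pow_eq_one (n := a * b * c) (by positivity)
    (u := Complex.exp (2 * α * Complex.I)) (v := Complex.exp (2 * β * Complex.I))
    (w := Complex.exp (2 * γ * Complex.I))
    (by rw [mul_assoc a, pow_mul, exp_two_mul_pow_eq_one ha hα, one_pow])
    (by rw [mul_comm a b, mul_assoc b, pow_mul, exp_two_mul_pow_eq_one hb hβ, one_pow])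
    (by rw [mul_comm (a * b), pow_mul, exp_two_mul_pow_eq_one hc hγ, one_pow])
  have hD : 4 * ((4 * Real.sin γ ^ 2 : ℝ) : ℂ) -
      ((4 * Real.sin α ^ 2 : ℝ) : ℂ) * ((4 * Real.sin β ^ 2 : ℝ) : ℂ) =
        ((16 * (Real.sin γ ^ 2 - Real.sin α ^ 2 * Real.sin β ^ 2) : ℝ) : ℂ) := by
    push_cast; ring
  rw [one_sub_exp_mul_one_sub_exp_inv, one_sub_exp_mul_one_sub_exp_inv,
    one_sub_exp_mul_one_sub_exp_inv, hD, Complex.norm_real, Real.norm_eq_abs] at key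
  refine key ?_
  exact_mod_cast mul_ne_zero (by norm_num) h0

theorem sin_sq_mul_sin_sq_ne_of_odd {i j k a b c : ℕ} (ha : 0 < a) (hb : Odd b) (hc : 0 < c)
    {α β γ : ℝ} (hα : α = i * Real.pi / a) (hβ : β = j * Real.pi / b) (hγ : γ = k * Real.pi / c)
    (hsα : Real.sin α ≠ 0) (hcα : Real.cos α ≠ 0) (hsβ : Real.sin β ≠ 0) :
    Real.sin α ^ 2 * Real.sin β ^ 2 ≠ Real.sin γ ^ 2 := by
  intro h
  have hn : 0 < a * b * c := by have := hb.pos; positivity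
  have : NeZero (a * b * c) := ⟨hn.ne'⟩
  let φ : CyclotomicField (a * b * c) ℚ →ₐ[ℚ] ℂ := IsAlgClosed.lift
  have hu := exp_two_mul_pow_eq_one ha hα
  have hv := exp_two_mul_pow_eq_one hb.pos hβ
  have hw := exp_two_mul_pow_eq_one hc hγ
  obtain ⟨u, -, hu'⟩ := exists_cyclotomicField_pow_eq_one (a * b * c) φ
    (u := Complex.exp (2 * α * Complex.I)) (by rw [mul_assoc a, pow_mul, hu, one_pow])
  obtain ⟨v, -, hv'⟩ := exists_cyclotomicField_pow_eq_one (a * b * c) φ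
    (u := Complex.exp (2 * β * Complex.I))
    (by rw [mul_comm a b, mul_assoc b, pow_mul, hv, one_pow])
  obtain ⟨w, -, hw'⟩ := exists_cyclotomicField_pow_eq_one (a * b * c) φ
    (u := Complex.exp (2 * γ * Complex.I)) (by rw [mul_comm (a * b), pow_mul, hw, one_pow])
  have hφ : Function.Injective φ := φ.injective
  refine one_sub_mul_one_sub_inv_mul_ne_of_odd (u := u) (v := v) (w := w) ha hc hb
    (hφ ?_) (hφ ?_) (hφ ?_) ?_ ?_ (hφ ?_)
  · rw [map_pow, hu', hu, map_one]
  · rw [map_pow, hv', hv, map_one]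
  · rw [map_pow, hw', hw, map_one]
  · intro hu2
    apply exp_two_mul_sq_ne_one hsα hcα
    rw [← hu', ← map_pow, hu2, map_one]
  · rintro rfl
    apply exp_two_mul_ne_one hsβ
    rw [← hv', map_one]
  · simp only [map_mul, map_sub, map_one, map_inv₀, map_ofNat, hu', hv', hw',
      one_sub_exp_mul_one_sub_exp_inv]
    have h' : (Real.sin α : ℂ) ^ 2 * (Real.sin β : ℂ) ^ 2 = (Real.sin γ : ℂ) ^ 2 := by
      exact_mod_cast h
    push_cast at h' ⊢
    linear_combination 16 * h'

theorem sin_sq_mul_sin_sq_ne_of_coprime {i j k a b c : ℕ} (ha : 0 < a) (hb : 0 < b) (hc : 0 < c)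
    (hab : Nat.Coprime a b) {α β γ : ℝ} (hα : α = i * Real.pi / a) (hβ : β = j * Real.pi / b)
    (hγ : γ = k * Real.pi / c) (hsα : Real.sin α ≠ 0) (hcα : Real.cos α ≠ 0)
    (hsβ : Real.sin β ≠ 0) (hcβ : Real.cos β ≠ 0) :
    Real.sin α ^ 2 * Real.sin β ^ 2 ≠ Real.sin γ ^ 2 := by
  rcases Nat.even_or_odd b with hb2 | hb2
  · have ha2 : Odd a := by
      rw [← Nat.not_even_iff_odd]
      intro ha2
      exact Nat.not_coprime_of_dvd_of_dvd (by norm_num) ha2.two_dvd hb2.two_dvd hab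
    rw [mul_comm]
    exact sin_sq_mul_sin_sq_ne_of_odd hb ha2 hc hβ hα hγ hsβ hcβ hsα
  · exact sin_sq_mul_sin_sq_ne_of_odd ha hb2 hc hα hβ hγ hsα hcα hsβ

/-- Jordan's inequality at π/2 - kπ/c gives cos(kπ/c) ≥ 1 - 2k/c, and c - 2k ≥ 1. -/
theorem one_le_mul_cos_of_two_mul_lt {k c : ℕ} (h : 2 * k < c) :
    1 ≤ c * Real.cos (k * Real.pi / c) := by
  have hc : (0 : ℝ) < c := by exact_mod_cast (by omega : 0 < c)
  have hk : (2 * k + 1 : ℝ) ≤ c := by exact_mod_cast h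
  have hπ := Real.pi_pos
  have hle : k * Real.pi / c ≤ Real.pi / 2 := by
    rw [div_le_div_iff₀ hc two_pos]; nlinarith
  have hnn : 0 ≤ k * Real.pi / c := by positivity
  have hsin := Real.mul_le_sin (x := Real.pi / 2 - k * Real.pi / c) (by linarith) (by linarith)
  rw [Real.sin_pi_div_two_sub] at hsin
  calc (1 : ℝ) ≤ c * (2 / Real.pi * (Real.pi / 2 - k * Real.pi / c)) := by
        field_simp
        linarith
    _ ≤ _ := by gcongr

theorem mul_pi_div_lt_pi_div_two {m n : ℕ} (h : 2 * m < n) :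
    m * Real.pi / n < Real.pi / 2 := by
  have hn : (0 : ℝ) < n := by exact_mod_cast (by omega : 0 < n)
  have h' : (2 * m : ℝ) < n := by exact_mod_cast h
  rw [div_lt_div_iff₀ hn two_pos]
  nlinarith [Real.pi_pos]

theorem sin_mul_pi_div_pos {m n : ℕ} (hm : 1 ≤ m) (h : m < n) :
    0 < Real.sin (m * Real.pi / n) := by
  have hm' : (0 : ℝ) < m := by exact_mod_cast hm
  have hn : (0 : ℝ) < n := by exact_mod_cast (by omega : 0 < n)
  have h' : (m : ℝ) < n := by exact_mod_cast h
  have hπ := Real.pi_pos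
  refine Real.sin_pos_of_pos_of_lt_pi (by positivity) ?_
  rw [div_lt_iff₀ hn]
  nlinarith

theorem sin_mul_pi_div_le_sin_mul_pi_div {m n k c : ℕ} (hmn : 0 < n) (hkc : 2 * k ≤ c)
    (h : m * c ≤ k * n) (hc : 0 < c) :
    Real.sin (m * Real.pi / n) ≤ Real.sin (k * Real.pi / c) := by
  have hn : (0 : ℝ) < n := by exact_mod_cast hmn
  have hc' : (0 : ℝ) < c := by exact_mod_cast hc
  have h' : (m * c : ℝ) ≤ k * n := by exact_mod_cast h
  have hkc' : (2 * k : ℝ) ≤ c := by exact_mod_cast hkc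
  have hπ := Real.pi_pos
  apply Real.sin_le_sin_of_le_of_le_pi_div_two
  · have : 0 ≤ m * Real.pi / n := by positivity
    linarith
  · rw [div_le_div_iff₀ hc' two_pos]
    nlinarith
  · rw [div_le_div_iff₀ hn hc']
    nlinarith

/-- Among the angles `m π / n` with `n ≤ c` and `2 m ≠ n`, none has a larger sine than
the multiple of `π / c` next to `π / 2`, for odd `c`. -/
theorem sin_mul_pi_div_le_of_le {m n k c : ℕ} (hmn : m ≤ n) (hn : 0 < n) (hne : 2 * m ≠ n)
    (hnc : n ≤ c) (hkc : 2 * k + 1 = c) :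
    Real.sin (m * Real.pi / n) ≤ Real.sin (k * Real.pi / c) := by
  have key : ∀ l : ℕ, 2 * l < n → Real.sin (l * Real.pi / n) ≤ Real.sin (k * Real.pi / c) := by
    intro l hl
    refine sin_mul_pi_div_le_sin_mul_pi_div hn (by omega) ?_ (by omega)
    subst hkc
    -- From 2l + 1 ≤ n ≤ 2k + 1: l(2k + 1) ≤ k(2l + 1) ≤ kn.
    nlinarith
  rcases Nat.lt_or_ge (2 * m) n with h | h
  · exact key m h
  -- Reflection in π/2 preserves the sine.
  · have h' := key (n - m) (by omega)
    have hn' : (n : ℝ) ≠ 0 := by exact_mod_cast hn.ne'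
    rwa [Nat.cast_sub hmn, show ((n : ℝ) - m) * Real.pi / n = Real.pi - m * Real.pi / n by
      field_simp, Real.sin_pi_sub] at h'

end Trigonometry

/-! ### The discriminant and its lower bound. -/

section FactorPoly

open Polynomial

/-- With A, B, G the squared sines, (1 - A)(1 - B)G - (G - A)(G - B) = (1 - G)(G - AB). -/
theorem factorDiscr_eq {α β γ : ℝ} (hγ : γ ≠ Real.pi / 2) (hs : Real.sin γ ≠ 0) :
    factorDiscr α β γ = Real.cos γ ^ 2 / Real.sin γ ^ 2 *
      (16 * (Real.sin γ ^ 2 - Real.sin α ^ 2 * Real.sin β ^ 2)) := by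
  have hdeg : (factorPoly α β γ).degree = 2 := by
    rw [factorPoly, if_neg hγ]
    compute_degree!
  rw [factorDiscr, discr_of_degree_eq_two hdeg, factorPoly, if_neg hγ]
  simp only [coeff_add, coeff_X_pow, coeff_C_mul, coeff_X, coeff_C]
  norm_num
  rw [Real.sin_sq α, Real.sin_sq β, Real.cos_sq' γ]
  field_simp
  ring

theorem not_hasDoubleRoot_factorPoly {α β γ : ℝ} (hγ : γ ≠ Real.pi / 2)
    (h : factorDiscr α β γ ≠ 0) : ¬ HasDoubleRoot (factorPoly α β γ) := by
  rintro ⟨z, hz⟩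
  have hdeg : (factorPoly α β γ).degree = 2 := by
    rw [factorPoly, if_neg hγ]
    compute_degree!
  have hne : (factorPoly α β γ).map (algebraMap ℝ ℂ) ≠ 0 := by
    rw [Polynomial.map_ne_zero_iff (algebraMap ℝ ℂ).injective]
    rintro h0
    simp [h0] at hdeg
  obtain ⟨h1, h2⟩ := (one_lt_rootMultiplicity_iff_isRoot hne).1 hz
  apply h
  rw [factorDiscr, discr_of_degree_eq_two hdeg]
  rw [factorPoly, if_neg hγ] at *
  generalize 4 * Real.cos α * Real.cos β = p at *
  generalize 4 * ((Real.cos α ^ 2 - Real.cos γ ^ 2) * (Real.cos β ^ 2 - Real.cos γ ^ 2)) /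
    Real.sin γ ^ 2 = q at *
  simp [IsRoot.def] at h1 h2
  simp only [coeff_add, coeff_X_pow, coeff_C_mul, coeff_X, coeff_C]
  norm_num
  have : (p : ℂ) ^ 2 - 4 * q = 0 := by
    linear_combination (2 * z + p) * h2 - 4 * h1
  exact_mod_cast this

theorem two_zpow_le_abs_factorDiscr {i j k a b c : ℕ} (ha : 0 < a) (hb : 2 ≤ b)
    (hk : 1 ≤ k) (hkc : 2 * k < c) {α β γ : ℝ} (hα : α = i * Real.pi / a)
    (hβ : β = j * Real.pi / b) (hγ : γ = k * Real.pi / c) (h0 : factorDiscr α β γ ≠ 0) :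
    (2 : ℝ) ^ (-(6 * (a * b * c : ℕ) : ℤ)) ≤ |factorDiscr α β γ| := by
  have hc : 0 < c := by omega
  have hb0 : 0 < b := by omega
  have hγ2 : γ < Real.pi / 2 := hγ ▸ mul_pi_div_lt_pi_div_two hkc
  have hs : 0 < Real.sin γ := hγ ▸ sin_mul_pi_div_pos hk (by omega)
  rw [factorDiscr_eq hγ2.ne hs.ne'] at h0 ⊢
  have hlow := one_le_abs_sin_sq_sub_mul_pow ha hb0 hc hα hβ hγ
    (right_ne_zero_of_mul (right_ne_zero_of_mul h0))
  have hcos : 1 ≤ c * Real.cos γ := hγ ▸ one_le_mul_cos_of_two_mul_lt hkc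
  have hcot : 1 ≤ (c : ℝ) ^ 2 * (Real.cos γ ^ 2 / Real.sin γ ^ 2) := by
    have h1 : 1 ≤ (c * Real.cos γ) ^ 2 := one_le_pow₀ hcos
    have h2 : Real.sin γ ^ 2 ≤ 1 := Real.sin_sq_le_one γ
    rw [← mul_div_assoc, ← mul_pow, le_div_iff₀ (by positivity)]
    linarith
  -- Here c² ≤ 2^(2c) and 2c ≤ abc because b ≥ 2, so the loss from cot²γ fits into one factor 2^n.
  have hpow : (c : ℝ) ^ 2 * 32 ^ (a * b * c - 1) ≤ 2 ^ (6 * (a * b * c)) := by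
    have h1 : (c : ℝ) ≤ 2 ^ c := by exact_mod_cast Nat.lt_two_pow_self.le
    have h2 : 2 * c ≤ a * b * c := Nat.mul_le_mul_right c (by nlinarith)
    calc (c : ℝ) ^ 2 * 32 ^ (a * b * c - 1) ≤ (2 ^ c) ^ 2 * (2 ^ 5) ^ (a * b * c - 1) := by
          norm_num
          gcongr
      _ = 2 ^ (c * 2 + 5 * (a * b * c - 1)) := by rw [pow_add, pow_mul, pow_mul]
      _ ≤ 2 ^ (6 * (a * b * c)) := pow_le_pow_right₀ (by norm_num) (by omega)
  set D := 16 * (Real.sin γ ^ 2 - Real.sin α ^ 2 * Real.sin β ^ 2)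
  have hq : 0 ≤ Real.cos γ ^ 2 / Real.sin γ ^ 2 := by positivity
  rw [abs_mul, abs_of_nonneg hq, zpow_neg, inv_le_iff_one_le_mul₀ (by positivity)]
  calc (1 : ℝ) ≤ (c ^ 2 * (Real.cos γ ^ 2 / Real.sin γ ^ 2)) * (|D| * 32 ^ (a * b * c - 1)) :=
        one_le_mul_of_one_le_of_one_le hcot hlow
    _ = (Real.cos γ ^ 2 / Real.sin γ ^ 2 * |D|) * (c ^ 2 * 32 ^ (a * b * c - 1)) := by ring
    _ ≤ (Real.cos γ ^ 2 / Real.sin γ ^ 2 * |D|) * 2 ^ (6 * (a * b * c)) := by gcongr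
    _ = _ := by
      congr 1

end FactorPoly

theorem mainTheorem10 (a b c i j : ℕ) (hc : 0 < c)
    (hi : 1 ≤ i) (hia : 2 * i + 1 ≤ a) (hj : 1 ≤ j) (hjb : j + 1 ≤ b)
    (α β : ℝ) (hα : α = i * Real.pi / a) (hβ : β = j * Real.pi / b) :
    (∀ k : ℕ, 1 ≤ k → 2 * k < c →
      factorDiscr α β (k * Real.pi / c) = 0 ∨
        (2 : ℝ) ^ (-(6 * (a * b * c : ℕ) : ℤ)) ≤ |factorDiscr α β (k * Real.pi / c)|) ∧
    (Nat.Coprime a b → β ≠ Real.pi / 2 →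
      (∀ k : ℕ, 1 ≤ k → 2 * k < c → ¬ HasDoubleRoot (factorPoly α β (k * Real.pi / c))) ∧
      ∃ (k₀ : ℕ) (γ₀ : ℝ), γ₀ = k₀ * (Real.pi / c) ∧
        1 ≤ k₀ ∧ k₀ ≤ (c + 1) / 2 ∧ (a ≤ c ∨ b ≤ c → k₀ ≤ c / 2) ∧
        ∀ (k : ℕ) (γ : ℝ), 1 ≤ k → 2 * k < c → γ = k * Real.pi / c →
          (γ < γ₀ → factorDiscr α β γ < 0) ∧
          (γ₀ ≤ γ → (2 : ℝ) ^ (-(6 * (a * b * c : ℕ) : ℤ)) ≤ factorDiscr α β γ)) := by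
  have ha0 : 0 < a := by omega
  have hb0 : 0 < b := by omega
  have hcR : (0 : ℝ) < c := by exact_mod_cast hc
  have hπ := Real.pi_pos
  have hbound : ∀ k : ℕ, 1 ≤ k → 2 * k < c → factorDiscr α β (k * Real.pi / c) ≠ 0 →
      (2 : ℝ) ^ (-(6 * (a * b * c : ℕ) : ℤ)) ≤ |factorDiscr α β (k * Real.pi / c)| :=
    fun k hk hkc h0 =>
      two_zpow_le_abs_factorDiscr ha0 (by omega) hk hkc hα hβ rfl h0
  refine ⟨fun k hk hkc => or_iff_not_imp_left.2 (hbound k hk hkc), fun hab hβ2 => ?_⟩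
  have hα2 : α < Real.pi / 2 := hα ▸ mul_pi_div_lt_pi_div_two (by omega)
  have hα0 : 0 < α := by
    have : (0 : ℝ) < i := by exact_mod_cast hi
    rw [hα]
    positivity
  have hsα : 0 < Real.sin α := hα ▸ sin_mul_pi_div_pos hi (by omega)
  have hcα : 0 < Real.cos α := Real.cos_pos_of_mem_Ioo ⟨by linarith, hα2⟩
  have hsβ : 0 < Real.sin β := hβ ▸ sin_mul_pi_div_pos hj (by omega)
  have hjb2 : 2 * j ≠ b := by
    rintro rfl
    apply hβ2
    have : (j : ℝ) ≠ 0 := by exact_mod_cast (by omega : j ≠ 0)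
    rw [hβ]
    push_cast
    field_simp
  have hcβ : Real.cos β ≠ 0 := by
    intro h
    rw [Real.cos_eq_zero_iff] at h
    obtain ⟨t, ht⟩ := h
    have hb' : (b : ℝ) ≠ 0 := by exact_mod_cast hb0.ne'
    have h2 : (2 * j : ℝ) = (2 * t + 1) * b := by
      rw [hβ] at ht
      field_simp at ht
      linarith
    have h3 : (2 * j : ℤ) = (2 * t + 1) * b := by exact_mod_cast h2
    -- 0 < 2j < 2b forces 0 < 2t + 1 < 2.
    have ht0 : t = 0 := by
      have h4 : -1 < t := by nlinarith
      have h5 : t < 1 := by nlinarith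
      omega
    subst ht0
    omega
  have hsα1 : Real.sin α < 1 := by nlinarith [Real.sin_sq_add_cos_sq α]
  have hsβ1 : Real.sin β < 1 := by
    have : 0 < Real.cos β ^ 2 := by positivity
    nlinarith [Real.sin_sq_add_cos_sq β]
  have hdiscr : ∀ k : ℕ, 1 ≤ k → 2 * k < c →
      factorDiscr α β (k * Real.pi / c) =
        Real.cos (k * Real.pi / c) ^ 2 / Real.sin (k * Real.pi / c) ^ 2 *
          (16 * (Real.sin (k * Real.pi / c) ^ 2 - Real.sin α ^ 2 * Real.sin β ^ 2)) :=
    fun k hk hkc => factorDiscr_eq (mul_pi_div_lt_pi_div_two hkc).ne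
      (sin_mul_pi_div_pos hk (by omega)).ne'
  have hfac : ∀ k : ℕ, 1 ≤ k → 2 * k < c →
      0 < Real.cos (k * Real.pi / c) ^ 2 / Real.sin (k * Real.pi / c) ^ 2 := by
    intro k hk hkc
    have h1 := sin_mul_pi_div_pos (n := c) hk (by omega)
    have h2 : 0 < Real.cos (k * Real.pi / c) :=
      Real.cos_pos_of_mem_Ioo ⟨by have : 0 ≤ k * Real.pi / c := by positivity
                                  linarith, mul_pi_div_lt_pi_div_two hkc⟩
    positivity
  have hne : ∀ k : ℕ, Real.sin α ^ 2 * Real.sin β ^ 2 ≠ Real.sin (k * Real.pi / c) ^ 2 :=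
    fun k => sin_sq_mul_sin_sq_ne_of_coprime ha0 hb0 hc hab hα hβ rfl hsα.ne' hcα.ne' hsβ.ne' hcβ
  have hdiscr0 : ∀ k : ℕ, 1 ≤ k → 2 * k < c → factorDiscr α β (k * Real.pi / c) ≠ 0 := by
    intro k hk hkc
    rw [hdiscr k hk hkc]
    exact mul_ne_zero (hfac k hk hkc).ne'
      (mul_ne_zero (by norm_num) (sub_ne_zero.2 (hne k).symm))
  refine ⟨fun k hk hkc => not_hasDoubleRoot_factorPoly (mul_pi_div_lt_pi_div_two hkc).ne
    (hdiscr0 k hk hkc), ?_⟩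
  classical
  -- k₀ is the least such k. The alternative c ≤ 2k makes it exist, equal to ⌈c/2⌉, even when every
  -- discriminant is negative.
  have hex : ∃ k : ℕ, 1 ≤ k ∧
      (c ≤ 2 * k ∨ Real.sin α * Real.sin β < Real.sin (k * Real.pi / c)) :=
    ⟨(c + 1) / 2, by omega, Or.inl (by omega)⟩
  have hspec := Nat.find_spec hex
  refine ⟨Nat.find hex, _, rfl, hspec.1, Nat.find_min' hex ⟨by omega, Or.inl (by omega)⟩, ?_, ?_⟩
  · intro hle
    refine Nat.find_min' hex ⟨by omega, ?_⟩
    rcases Nat.even_or_odd' c with ⟨t, ht | ht⟩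
    · exact Or.inl (by omega)
    · refine Or.inr ?_
      have hodd : 2 * (c / 2) + 1 = c := by omega
      -- For odd c, sin(⌊c/2⌋π/c) is at least sin α or sin β, and the other sine being below 1 makes
      -- the product strictly smaller.
      rcases hle with h | h
      · have h1 := sin_mul_pi_div_le_of_le (m := i) (n := a) (by omega) ha0 (by omega) h hodd
        rw [← hα] at h1
        nlinarith
      · have h1 := sin_mul_pi_div_le_of_le (m := j) (n := b) (by omega) hb0 hjb2 h hodd
        rw [← hβ] at h1
        nlinarith
  · rintro k γ hk hkc rfl
    have hsk := sin_mul_pi_div_pos (n := c) hk (by omega)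
    have hprod : 0 < Real.sin α * Real.sin β := mul_pos hsα hsβ
    rw [← mul_div_assoc]
    constructor
    · intro hlt
      have hlt' : k < Nat.find hex := by
        rw [div_lt_div_iff_of_pos_right hcR, mul_lt_mul_iff_left₀ hπ] at hlt
        exact_mod_cast hlt
      have hmin := Nat.find_min hex hlt'
      push Not at hmin
      have hle := (hmin hk).2
      rw [hdiscr k hk hkc]
      refine mul_neg_of_pos_of_neg (hfac k hk hkc) ?_
      have hsq : Real.sin (k * Real.pi / c) ^ 2 ≤ (Real.sin α * Real.sin β) ^ 2 := by gcongr
      rw [mul_pow] at hsq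
      -- Minimality gives only ≤; the arithmetic nonvanishing makes it strict.
      have := lt_of_le_of_ne hsq (hne k).symm
      linarith
    · intro hge
      have hge' : Nat.find hex ≤ k := by
        rw [div_le_div_iff_of_pos_right hcR, mul_le_mul_iff_left₀ hπ] at hge
        exact_mod_cast hge
      have hlt := hspec.2.resolve_left (by omega)
      have hmono := sin_mul_pi_div_le_sin_mul_pi_div (m := Nat.find hex) (k := k) hc
        hkc.le (Nat.mul_le_mul_right c hge') hc
      have hpos : 0 < factorDiscr α β (k * Real.pi / c) := by
        rw [hdiscr k hk hkc]
        refine mul_pos (hfac k hk hkc) ?_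
        have hsq : (Real.sin α * Real.sin β) ^ 2 < Real.sin (k * Real.pi / c) ^ 2 := by
          have := hlt.trans_le hmono
          gcongr
        rw [mul_pow] at hsq
        linarith
      have hb := hbound k hk hkc hpos.ne'
      rwa [abs_of_pos hpos] at hb
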